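/- **Path categories.** Let $\mathcal C$ be a category equipped with two classes of maps, called *fibrations* and *weak equivalences*; a map in both classes is an *acyclic fibration*. $\mathcal C$ is a *path category* if: 1. fibrations are closed under composition; 2. the pullback of a fibration along any map exists and is again a fibration; 3. the pullback of an acyclic fibration along any map is again an acyclic fibration; 4. (2-out-of-6) if $f: A \to B$, $g: B \to C$, $h: C \to D$ are maps such that $gf$ and $hg$ are weak equivalences, then so are $f$, $g$, $h$ and $hgf$; 5. isomorphisms are acyclic fibrations, and every acyclic fibration has a section; 6. every object $B$ has a path object, i.e. the diagonal $B \to B \times B$ factors as a weak equivalence $B \to PB$ followed by a fibration $PB \to B \times B$; 7. $\mathcal C$ has a terminal object $1$ and every map $X \to 1$ is a fibration. (Binary products exist by 2 and 7.) **The homotopy exact completion.** A *homotopy equivalence relation* on an object $X$ of $\mathcal C$ is a fibration $p = (p_1,p_2): R \to X \times X$ for which there are maps $\rho: X \to R$ with $p\rho = \Delta_X$, $\sigma: R \to R$ with $p_1\sigma = p_2$ and $p_2\sigma = p_1$, and $\tau: R \times_X R \to R$ with $p_1\tau = p_1q_1$ and $p_2\tau = p_2q_2$, where $q_1, q_2: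 R \times_X R \to R$ are the projections of the pullback of $p_2$ along $p_1$ (so $p_2q_1 = p_1q_2$). The category $\mathrm{Hex}(\mathcal C)$ has as objects the pairs $(X, \rho: R \to X \times X)$ with $\rho$ a homotopy equivalence relation on $X$. A morphism $(X, \rho: R \to X \times X) \to (Y, \sigma: S \to Y \times Y)$ is an equivalence class of maps $f: X \to Y$ in $\mathcal C$ for which there is a map $\varphi: R \to S$ with $\sigma\varphi = (f \times f)\rho$; two such maps $f, g$ are identified if there is a map $H: X \to S$ with $\sigma H = (f,g)$. Identities and composition are induced from $\mathcal C$. **Exact categories.** In a category $\mathcal E$, a map $f: B \to A$ is a *cover* if every mono into $A$ through which $f$ factors is an isomorphism. $\mathcal E$ is *regular* if it has all finite limits, every map factors as a cover followed by a mono, and the pullback of a cover along any map is a cover. A mono $m = (m_1,m_2): R \to X \times X$ is an *equivalence relation* if for every object $P$ the image of $\mathrm{Hom}(P,R) \to \mathrm{Hom}(P,X) \times \mathrm{Hom}(P,X)$ is an equivalence relation on $\mathrm{Hom}(P,X)$; a *quotient* of it is a cover $q: X \to Q$ such that $$\begin{array}{ccc} R & \xrightarrow{\;m_1\;} & X \\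 {\scriptstyle m_2}\downarrow & & \downarrow{\scriptstyle q} \\ X & \xrightarrow{\;q\;} & Q \end{array}$$ is a pullback. $\mathcal E$ is *exact* if it is regular and every equivalence relation in $\mathcal E$ has a quotient. **Theorem.** For every path category $\mathcal C$, the category $\mathrm{Hex}(\mathcal C)$ is exact. -/

import Mathlib

open CategoryTheory CategoryTheory.Limits HomotopicalAlgebra

universe v u

/-! ## Path categories

The fibrations and the weak equivalences are the two classes of maps carried by Mathlib's
`CategoryWithFibrations` and `CategoryWithWeakEquivalences`; an acyclic fibration is a member of
`trivialFibrations C`, the intersection of the two classes. -/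

/-- All axioms of a path category except the existence of path objects.  This auxiliary class
comes first because path objects are formulated with the product `B ⨯ B`, and the existence of
binary products is a consequence of the axioms below. -/
class PrePathCategory (C : Type u) [Category.{v} C] [CategoryWithFibrations C]
    [CategoryWithWeakEquivalences C] : Prop where
  /-- Fibrations are closed under composition. -/
  fibration_comp : ∀ {X Y Z : C} (f : X ⟶ Y) (g : Y ⟶ Z),
    fibrations C f → fibrations C g → fibrations C (f ≫ g)
  /-- The pullback of a fibration along any map exists. -/
  hasPullback_of_fibration : ∀ {X Y Z : C} (f : X ⟶ Z) (p : Y ⟶ Z),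
    fibrations C p → HasPullback f p
  /-- The pullback of a fibration along any map is a fibration. -/
  fibration_of_isPullback : ∀ {W X Y Z : C} {p' : W ⟶ X} {f' : W ⟶ Y} {f : X ⟶ Z} {p : Y ⟶ Z},
    IsPullback p' f' f p → fibrations C p → fibrations C p'
  /-- The pullback of an acyclic fibration along any map is an acyclic fibration. -/
  trivialFibration_of_isPullback :
    ∀ {W X Y Z : C} {p' : W ⟶ X} {f' : W ⟶ Y} {f : X ⟶ Z} {p : Y ⟶ Z},
      IsPullback p' f' f p → trivialFibrations C p → trivialFibrations C p'
  /-- Weak equivalences satisfy 2-out-of-6. -/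
  two_out_of_six : ∀ {X Y Z W : C} (f : X ⟶ Y) (g : Y ⟶ Z) (h : Z ⟶ W),
    weakEquivalences C (f ≫ g) → weakEquivalences C (g ≫ h) →
      weakEquivalences C f ∧ weakEquivalences C g ∧ weakEquivalences C h ∧
        weakEquivalences C (f ≫ g ≫ h)
  /-- Isomorphisms are acyclic fibrations. -/
  trivialFibration_of_isIso : ∀ {X Y : C} (f : X ⟶ Y), IsIso f → trivialFibrations C f
  /-- Every acyclic fibration has a section. -/
  exists_section : ∀ {X Y : C} (f : X ⟶ Y), trivialFibrations C f → ∃ s : Y ⟶ X, s ≫ f = 𝟙 Y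
  /-- There is a terminal object. -/
  hasTerminal : HasTerminal C
  /-- Every map to a terminal object is a fibration. -/
  fibration_of_isTerminal : ∀ {X T : C} (f : X ⟶ T), IsTerminal T → fibrations C f

theorem PrePathCategory.hasBinaryProducts (C : Type u) [Category.{v} C] [CategoryWithFibrations C]
    [CategoryWithWeakEquivalences C] [PrePathCategory C] : HasBinaryProducts C := by
  have : HasTerminal C := PrePathCategory.hasTerminal
  have : ∀ X Y : C, HasLimit (pair X Y) := fun X Y => by
    have : HasPullback (terminal.from X) (terminal.from Y) :=
      PrePathCategory.hasPullback_of_fibration _ _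
        (PrePathCategory.fibration_of_isTerminal _ terminalIsTerminal)
    exact HasLimit.mk ⟨_, isProductOfIsTerminalIsPullback _ _ _ _ terminalIsTerminal
      (pullbackIsPullback (terminal.from X) (terminal.from Y))⟩
  exact hasBinaryProducts_of_hasLimit_pair C

instance (C : Type u) [Category.{v} C] [CategoryWithFibrations C]
    [CategoryWithWeakEquivalences C] [PrePathCategory C] : HasBinaryProducts C :=
  PrePathCategory.hasBinaryProducts C

/-- A path category: in addition to the axioms above, every object `B` has a path object, that is,
a factorisation of the diagonal `B ⟶ B ⨯ B` as a weak equivalence followed by a fibration. -/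
class PathCategory (C : Type u) [Category.{v} C] [CategoryWithFibrations C]
    [CategoryWithWeakEquivalences C] : Prop extends PrePathCategory C where
  exists_pathObject : ∀ B : C, ∃ (PB : C) (r : B ⟶ PB) (p : PB ⟶ B ⨯ B),
    weakEquivalences C r ∧ fibrations C p ∧ r ≫ p = diag B

/-! ## Homotopy equivalence relations and the homotopy exact completion -/

section HexDefs

variable {C : Type u} [Category.{v} C] [CategoryWithFibrations C]
  [CategoryWithWeakEquivalences C] [PathCategory C]

/-- A fibration `p = (p₁, p₂) : R ⟶ X ⨯ X` which is (non-uniquely) reflexive, symmetric and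
transitive.  The pullback `R ×_X R` in the last clause always exists, because `p₁` is a
fibration. -/
structure IsHomotopyEquivalenceRelation {X R : C} (p : R ⟶ X ⨯ X) : Prop where
  fibration : fibrations C p
  refl : ∃ ρ : X ⟶ R, ρ ≫ p = diag X
  symm : ∃ σ : R ⟶ R, σ ≫ p ≫ prod.fst = p ≫ prod.snd ∧ σ ≫ p ≫ prod.snd = p ≫ prod.fst
  trans : ∃ (P : C) (q₁ q₂ : P ⟶ R) (_ : IsPullback q₁ q₂ (p ≫ prod.snd) (p ≫ prod.fst))
    (τ : P ⟶ R), τ ≫ p ≫ prod.fst = q₁ ≫ p ≫ prod.fst ∧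
      τ ≫ p ≫ prod.snd = q₂ ≫ p ≫ prod.snd

namespace IsHomotopyEquivalenceRelation

variable {X R : C} {p : R ⟶ X ⨯ X}

theorem refl_lift (h : IsHomotopyEquivalenceRelation p) {I : C} (a : I ⟶ X) :
    ∃ H : I ⟶ R, H ≫ p = prod.lift a a := by
  obtain ⟨ρ, hρ⟩ := h.refl
  exact ⟨a ≫ ρ, by ext <;> simp [hρ]⟩

theorem symm_lift (h : IsHomotopyEquivalenceRelation p) {I : C} {a b : I ⟶ X}
    (hab : ∃ H : I ⟶ R, H ≫ p = prod.lift a b) : ∃ H : I ⟶ R, H ≫ p = prod.lift b a := by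
  obtain ⟨σ, h₁, h₂⟩ := h.symm
  obtain ⟨H, hH⟩ := hab
  have e₁ : H ≫ p ≫ prod.fst = a := by rw [← Category.assoc, hH, prod.lift_fst]
  have e₂ : H ≫ p ≫ prod.snd = b := by rw [← Category.assoc, hH, prod.lift_snd]
  refine ⟨H ≫ σ, ?_⟩
  ext
  · rw [Category.assoc, Category.assoc, h₁, e₂, prod.lift_fst]
  · rw [Category.assoc, Category.assoc, h₂, e₁, prod.lift_snd]

theorem trans_lift (h : IsHomotopyEquivalenceRelation p) {I : C} {a b c : I ⟶ X}
    (hab : ∃ H : I ⟶ R, H ≫ p = prod.lift a b) (hbc : ∃ H : I ⟶ R, H ≫ p = prod.lift b c) :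
    ∃ H : I ⟶ R, H ≫ p = prod.lift a c := by
  obtain ⟨P, q₁, q₂, sq, τ, h₁, h₂⟩ := h.trans
  obtain ⟨H, hH⟩ := hab
  obtain ⟨K, hK⟩ := hbc
  have e₁ : H ≫ p ≫ prod.fst = a := by rw [← Category.assoc, hH, prod.lift_fst]
  have e₂ : H ≫ p ≫ prod.snd = b := by rw [← Category.assoc, hH, prod.lift_snd]
  have e₃ : K ≫ p ≫ prod.fst = b := by rw [← Category.assoc, hK, prod.lift_fst]
  have e₄ : K ≫ p ≫ prod.snd = c := by rw [← Category.assoc, hK, prod.lift_snd]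
  refine ⟨sq.lift H K (e₂.trans e₃.symm) ≫ τ, ?_⟩
  ext
  · rw [Category.assoc, Category.assoc, h₁, ← Category.assoc, sq.lift_fst, e₁, prod.lift_fst]
  · rw [Category.assoc, Category.assoc, h₂, ← Category.assoc, sq.lift_snd, e₄, prod.lift_snd]

end IsHomotopyEquivalenceRelation

end HexDefs

/-- The objects of the homotopy exact completion of `C`: objects `X` of `C` with a homotopy
equivalence relation `ρ : R ⟶ X ⨯ X`. -/
structure Hex (C : Type u) [Category.{v} C] [CategoryWithFibrations C]
    [CategoryWithWeakEquivalences C] [PathCategory C] where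
  X : C
  R : C
  ρ : R ⟶ X ⨯ X
  isHomotopyEquivalenceRelation : IsHomotopyEquivalenceRelation ρ

namespace Hex

variable {C : Type u} [Category.{v} C] [CategoryWithFibrations C]
  [CategoryWithWeakEquivalences C] [PathCategory C]

/-- The maps `f : X ⟶ Y` in `C` for which there is a `φ : R ⟶ S` making the square with
`f × f` commute. -/
def TrackedHom (A B : Hex C) : Type v :=
  { f : A.X ⟶ B.X // ∃ φ : A.R ⟶ B.R, φ ≫ B.ρ = A.ρ ≫ prod.map f f }

/-- Two tracked maps `f, g : X ⟶ Y` are identified if `(f, g) : X ⟶ Y ⨯ Y` factors through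
`σ : S ⟶ Y ⨯ Y`. -/
instance trackedHomSetoid (A B : Hex C) : Setoid (TrackedHom A B) where
  r f g := ∃ H : A.X ⟶ B.R, H ≫ B.ρ = prod.lift f.1 g.1
  iseqv :=
    ⟨fun f => B.isHomotopyEquivalenceRelation.refl_lift f.1,
      fun h => B.isHomotopyEquivalenceRelation.symm_lift h,
      fun h k => B.isHomotopyEquivalenceRelation.trans_lift h k⟩

namespace TrackedHom

def id (A : Hex C) : TrackedHom A A := ⟨𝟙 A.X, 𝟙 A.R, by simp⟩

def comp {A B D : Hex C} (f : TrackedHom A B) (g : TrackedHom B D) : TrackedHom A D :=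
  ⟨f.1 ≫ g.1, by
    obtain ⟨φ, hφ⟩ := f.2
    obtain ⟨ψ, hψ⟩ := g.2
    exact ⟨φ ≫ ψ, by rw [Category.assoc, hψ, ← Category.assoc, hφ, Category.assoc, prod.map_map]⟩⟩

theorem comp_congr {A B D : Hex C} {f f' : TrackedHom A B} {g g' : TrackedHom B D}
    (hf : f ≈ f') (hg : g ≈ g') : comp f g ≈ comp f' g' := by
  obtain ⟨H, hH⟩ := hf
  obtain ⟨K, hK⟩ := hg
  obtain ⟨ψ, hψ⟩ := g.2
  refine D.isHomotopyEquivalenceRelation.trans_lift (b := f'.1 ≫ g.1)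
    ⟨H ≫ ψ, ?_⟩ ⟨f'.1 ≫ K, ?_⟩
  · rw [Category.assoc, hψ, ← Category.assoc, hH, prod.lift_map]
    rfl
  · rw [Category.assoc, hK, prod.comp_lift]
    rfl

end TrackedHom

/-- The homotopy exact completion of the path category `C`. -/
instance : Category.{v} (Hex C) where
  Hom A B := Quotient (trackedHomSetoid A B)
  id A := Quotient.mk _ (TrackedHom.id A)
  comp f g := Quotient.map₂ TrackedHom.comp
    (fun _ _ hf _ _ hg => TrackedHom.comp_congr hf hg) f g
  id_comp := by
    rintro A B ⟨f⟩
    exact congrArg (Quotient.mk _) (Subtype.ext (Category.id_comp f.1))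
  comp_id := by
    rintro A B ⟨f⟩
    exact congrArg (Quotient.mk _) (Subtype.ext (Category.comp_id f.1))
  assoc := by
    rintro A B D E ⟨f⟩ ⟨g⟩ ⟨h⟩
    exact congrArg (Quotient.mk _) (Subtype.ext (Category.assoc f.1 g.1 h.1))

end Hex

/-! ## Exact categories -/

/-- A map `f : B ⟶ A` is a cover if the only subobject of `A` through which it factors is the
maximal one: every mono into `A` through which `f` factors is an isomorphism. -/
def IsCover {E : Type u} [Category.{v} E] {B A : E} (f : B ⟶ A) : Prop :=
  ∀ ⦃Z : E⦄ (m : Z ⟶ A), Mono m → (∃ g : B ⟶ Z, g ≫ m = f) → IsIso m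

/-- A regular category: finite limits, cover/mono factorisations and pullback-stable covers. -/
class IsRegularCategory (E : Type u) [Category.{v} E] : Prop extends HasFiniteLimits E where
  exists_factorisation : ∀ {B A : E} (f : B ⟶ A),
    ∃ (I : E) (e : B ⟶ I) (m : I ⟶ A), IsCover e ∧ Mono m ∧ e ≫ m = f
  cover_of_isPullback : ∀ {W X Y Z : E} {e' : W ⟶ X} {f' : W ⟶ Y} {f : X ⟶ Z} {e : Y ⟶ Z},
    IsPullback e' f' f e → IsCover e → IsCover e'

/-- A subobject `m : R ⟶ X ⨯ X` is an equivalence relation if for every object `P` the image of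
`Hom(P, R)` in `Hom(P, X) × Hom(P, X)` is an equivalence relation. -/
structure IsInternalEquivalenceRelation {E : Type u} [Category.{v} E] [HasBinaryProducts E]
    {X R : E} (m : R ⟶ X ⨯ X) : Prop where
  mono : Mono m
  equivalence : ∀ P : E, Equivalence
    (fun a b : P ⟶ X => ∃ r : P ⟶ R, r ≫ m ≫ prod.fst = a ∧ r ≫ m ≫ prod.snd = b)

/-- A quotient of the relation `m : R ⟶ X ⨯ X` is a cover `q : X ⟶ Q` whose kernel pair is `R`
with its two projections. -/
def IsQuotientOf {E : Type u} [Category.{v} E] [HasBinaryProducts E] {X R Q : E}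
    (m : R ⟶ X ⨯ X) (q : X ⟶ Q) : Prop :=
  IsCover q ∧ IsPullback (m ≫ prod.fst) (m ≫ prod.snd) q q

/-- An exact category: a regular category in which every equivalence relation has a quotient. -/
class IsExactCategory (E : Type u) [Category.{v} E] : Prop extends IsRegularCategory E where
  exists_quotient : ∀ {X R : E} (m : R ⟶ X ⨯ X), IsInternalEquivalenceRelation m →
    ∃ (Q : E) (q : X ⟶ Q), IsQuotientOf m q

-- A fibration is treated as a predicate on generalized elements: an element satisfies it when it
-- lifts. An object of `Hex C` is then an object of `C` whose generalized elements carry an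
-- equivalence relation `Rel`, and a morphism is a `Rel`-preserving map, taken up to `Rel`. In these
-- terms monos are the maps reflecting `Rel` (`mono_homMk_iff`), and covers are the maps with a
-- section in `C` up to `Rel`, which need not preserve `Rel` (`isCover_homMk_iff`). So images and
-- quotients keep the underlying object and only coarsen the relation. The strict lifting property
-- in `exists_isPullback` carries sections along pullbacks. For quotients,
-- `exists_fibration_spanRel` realizes the coarser relation by a fibration, and joint monicity
-- (`rel_of_jointly_mono`) makes witnesses into morphisms.

attribute [local simp] prod.lift_fst prod.lift_snd prod.lift_fst_assoc prod.lift_snd_assoc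
  pullback.lift_fst pullback.lift_snd pullback.lift_fst_assoc pullback.lift_snd_assoc

/-! ### Fibrations as predicates on generalized elements -/

namespace PrePathCategory

variable {C : Type u} [Category.{v} C] [CategoryWithFibrations C]
  [CategoryWithWeakEquivalences C] [PrePathCategory C]

/-- Substitution into a predicate, by pulling back its fibration. -/
theorem exists_comap {A B E : C} (k : A ⟶ B) {p : E ⟶ B} (hp : fibrations C p) :
    ∃ (E' : C) (p' : E' ⟶ A), fibrations C p' ∧
      ∀ {I : C} (a : I ⟶ A), (∃ H, H ≫ p' = a) ↔ ∃ H, H ≫ p = a ≫ k := by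
  have := hasPullback_of_fibration k p hp
  refine ⟨pullback k p, pullback.fst k p,
    fibration_of_isPullback (IsPullback.of_hasPullback k p) hp, fun a => ⟨?_, ?_⟩⟩
  · rintro ⟨H, rfl⟩
    exact ⟨H ≫ pullback.snd k p, by simp [pullback.condition]⟩
  · rintro ⟨H, hH⟩
    exact ⟨pullback.lift a H hH.symm, by simp⟩

/-- Conjunction of predicates: the fibre product over `B`. -/
theorem exists_inf {B E E' : C} {p : E ⟶ B} {p' : E' ⟶ B} (hp : fibrations C p)
    (hp' : fibrations C p') :
    ∃ (E'' : C) (p'' : E'' ⟶ B), fibrations C p'' ∧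
      ∀ {I : C} (a : I ⟶ B), (∃ H, H ≫ p'' = a) ↔ (∃ H, H ≫ p = a) ∧ ∃ H, H ≫ p' = a := by
  have := hasPullback_of_fibration p p' hp'
  refine ⟨pullback p p', pullback.fst p p' ≫ p, fibration_comp _ _
    (fibration_of_isPullback (IsPullback.of_hasPullback p p') hp') hp, fun a => ⟨?_, ?_⟩⟩
  · rintro ⟨H, rfl⟩
    exact ⟨⟨H ≫ pullback.fst p p', by simp⟩,
      ⟨H ≫ pullback.snd p p', by simp [pullback.condition]⟩⟩
  · rintro ⟨⟨H, rfl⟩, ⟨H', h⟩⟩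
    exact ⟨pullback.lift H H' h.symm, by simp⟩

theorem fibration_snd (A B : C) : fibrations C (prod.snd : A ⨯ B ⟶ B) := by
  have := hasTerminal (C := C)
  exact fibration_of_isPullback (IsPullback.of_isLimit_binaryFan_of_isTerminal
    (prodIsProd A B) terminalIsTerminal).flip (fibration_of_isTerminal _ terminalIsTerminal)

theorem fibration_fst (A B : C) : fibrations C (prod.fst : A ⨯ B ⟶ A) := by
  have := hasTerminal (C := C)
  exact fibration_of_isPullback (IsPullback.of_isLimit_binaryFan_of_isTerminal
    (prodIsProd A B) terminalIsTerminal) (fibration_of_isTerminal _ terminalIsTerminal)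

end PrePathCategory

/-! ### Relations on generalized elements and their realizations -/

namespace Hex

variable {C : Type u} [Category.{v} C] [CategoryWithFibrations C]
  [CategoryWithWeakEquivalences C] [PathCategory C]

/-- Generalized elements of `A.X` which are related by the homotopy equivalence relation. -/
def Rel (A : Hex C) {I : C} (a b : I ⟶ A.X) : Prop := ∃ H : I ⟶ A.R, H ≫ A.ρ = prod.lift a b

namespace Rel

variable {A : Hex C} {I J : C} {a b c : I ⟶ A.X}

theorem refl (a : I ⟶ A.X) : A.Rel a a := A.isHomotopyEquivalenceRelation.refl_lift a

theorem symm (h : A.Rel a b) : A.Rel b a := A.isHomotopyEquivalenceRelation.symm_lift h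

theorem trans (h : A.Rel a b) (k : A.Rel b c) : A.Rel a c :=
  A.isHomotopyEquivalenceRelation.trans_lift h k

theorem precomp (h : A.Rel a b) (i : J ⟶ I) : A.Rel (i ≫ a) (i ≫ b) := by
  obtain ⟨H, hH⟩ := h
  exact ⟨i ≫ H, by rw [Category.assoc, hH, prod.comp_lift]⟩

theorem equivalence (A : Hex C) (I : C) : Equivalence (A.Rel (I := I)) :=
  ⟨refl, symm, trans⟩

end Rel

/-- A Yoneda argument: the structure maps come from applying the equivalence laws to the generic
elements, namely the projections of `R` and of `R ×_X R`. -/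
theorem isHomotopyEquivalenceRelation_of_equivalence {X R : C} (p : R ⟶ X ⨯ X) (hp : fibrations C p)
    (r : ∀ ⦃I : C⦄, (I ⟶ X) → (I ⟶ X) → Prop) (hr : ∀ I, Equivalence (r (I := I)))
    (h : ∀ {I : C} (a b : I ⟶ X), (∃ H, H ≫ p = prod.lift a b) ↔ r a b) :
    IsHomotopyEquivalenceRelation p where
  fibration := hp
  refl := (h (𝟙 X) (𝟙 X)).2 ((hr X).refl _)
  symm := by
    obtain ⟨σ, hσ⟩ := (h (p ≫ prod.snd) (p ≫ prod.fst)).2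
      ((hr R).symm ((h _ _).1 ⟨𝟙 R, by ext <;> simp⟩))
    exact ⟨σ, by rw [reassoc_of% hσ, prod.lift_fst], by rw [reassoc_of% hσ, prod.lift_snd]⟩
  trans := by
    have := PrePathCategory.hasPullback_of_fibration (p ≫ prod.snd) (p ≫ prod.fst)
      (PrePathCategory.fibration_comp _ _ hp (PrePathCategory.fibration_fst X X))
    let q₁ := pullback.fst (p ≫ prod.snd) (p ≫ prod.fst)
    let q₂ := pullback.snd (p ≫ prod.snd) (p ≫ prod.fst)
    have h₁ : r (q₁ ≫ p ≫ prod.fst) (q₁ ≫ p ≫ prod.snd) := (h _ _).1 ⟨q₁, by ext <;> simp⟩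
    have h₂ : r (q₁ ≫ p ≫ prod.snd) (q₂ ≫ p ≫ prod.snd) := (h _ _).1 ⟨q₂, by
      ext
      · simp [q₁, q₂, pullback.condition]
      · simp⟩
    obtain ⟨τ, hτ⟩ := (h _ _).2 ((hr _).trans h₁ h₂)
    exact ⟨_, q₁, q₂, IsPullback.of_hasPullback _ _, τ,
      by rw [reassoc_of% hτ, prod.lift_fst], by rw [reassoc_of% hτ, prod.lift_snd]⟩

/-- An object of `Hex C` on `X` whose relation on generalized elements is `r`. -/
structure Realization (X : C) (r : ∀ ⦃I : C⦄, (I ⟶ X) → (I ⟶ X) → Prop) where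
  R : C
  ρ : R ⟶ X ⨯ X
  isHER : IsHomotopyEquivalenceRelation ρ
  rel_iff' : ∀ {I : C} (a b : I ⟶ X), (∃ H, H ≫ ρ = prod.lift a b) ↔ r a b

namespace Realization

variable {X : C} {r : ∀ ⦃I : C⦄, (I ⟶ X) → (I ⟶ X) → Prop}

abbrev toHex (S : Realization X r) : Hex C := ⟨X, S.R, S.ρ, S.isHER⟩

theorem rel_iff (S : Realization X r) {I : C} (a b : I ⟶ X) : S.toHex.Rel a b ↔ r a b :=
  S.rel_iff' a b

theorem nonempty_comap (A : Hex C) (f : X ⟶ A.X) :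
    Nonempty (Realization X fun _ a b => A.Rel (a ≫ f) (b ≫ f)) := by
  obtain ⟨R, p, hp, h⟩ := PrePathCategory.exists_comap (prod.map f f)
    A.isHomotopyEquivalenceRelation.fibration
  have h' : ∀ {I : C} (a b : I ⟶ X),
      (∃ H, H ≫ p = prod.lift a b) ↔ A.Rel (a ≫ f) (b ≫ f) := fun a b => by
    rw [h, prod.lift_map]
    rfl
  exact ⟨⟨R, p, isHomotopyEquivalenceRelation_of_equivalence p hp _
    (fun I => (Rel.equivalence A I).comap (· ≫ f)) h', h'⟩⟩

theorem nonempty_inf {s : ∀ ⦃I : C⦄, (I ⟶ X) → (I ⟶ X) → Prop}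
    (S : Realization X r) (T : Realization X s) :
    Nonempty (Realization X fun _ a b => r a b ∧ s a b) := by
  obtain ⟨R, p, hp, h⟩ := PrePathCategory.exists_inf S.isHER.fibration T.isHER.fibration
  have h' : ∀ {I : C} (a b : I ⟶ X), (∃ H, H ≫ p = prod.lift a b) ↔ r a b ∧ s a b :=
    fun a b => by rw [h, S.rel_iff', T.rel_iff']
  refine ⟨⟨R, p, isHomotopyEquivalenceRelation_of_equivalence p hp _ (fun I => ?_) h', h'⟩⟩
  simp only [← S.rel_iff, ← T.rel_iff]
  exact ⟨fun a => ⟨Rel.refl (A := S.toHex) a, Rel.refl (A := T.toHex) a⟩,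
    fun h => ⟨Rel.symm h.1, Rel.symm h.2⟩,
    fun h k => ⟨Rel.trans h.1 k.1, Rel.trans h.2 k.2⟩⟩

theorem nonempty_comap₂ (A B : Hex C) (f : X ⟶ A.X) (g : X ⟶ B.X) :
    Nonempty (Realization X fun _ a b => A.Rel (a ≫ f) (b ≫ f) ∧ B.Rel (a ≫ g) (b ≫ g)) := by
  obtain ⟨S⟩ := nonempty_comap A f
  obtain ⟨T⟩ := nonempty_comap B g
  exact nonempty_inf S T

end Realization

/-! ### Morphisms through representatives -/

/-- A map of `C` preserving related generalized elements. -/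
def Preserves (A B : Hex C) (f : A.X ⟶ B.X) : Prop :=
  ∀ ⦃I : C⦄ (a b : I ⟶ A.X), A.Rel a b → B.Rel (a ≫ f) (b ≫ f)

theorem preserves_iff {A B : Hex C} (f : A.X ⟶ B.X) :
    Preserves A B f ↔ ∃ φ : A.R ⟶ B.R, φ ≫ B.ρ = A.ρ ≫ prod.map f f := by
  constructor
  · intro h
    obtain ⟨φ, hφ⟩ := h (A.ρ ≫ prod.fst) (A.ρ ≫ prod.snd) ⟨𝟙 _, by ext <;> simp⟩
    exact ⟨φ, by rw [hφ]; ext <;> simp⟩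
  · rintro ⟨φ, hφ⟩ I a b ⟨H, hH⟩
    exact ⟨H ≫ φ, by rw [Category.assoc, hφ, reassoc_of% hH, prod.lift_map]⟩

/-- The morphism of `Hex C` represented by a map preserving related elements. -/
def homMk {A B : Hex C} (f : A.X ⟶ B.X) (hf : Preserves A B f) : A ⟶ B :=
  Quotient.mk (trackedHomSetoid A B) ⟨f, (preserves_iff f).1 hf⟩

theorem exists_homMk {A B : Hex C} (u : A ⟶ B) : ∃ f hf, u = homMk f hf := by
  obtain ⟨⟨f, hf⟩, rfl⟩ := Quotient.exists_rep u
  exact ⟨f, (preserves_iff f).2 hf, rfl⟩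

theorem homMk_eq_iff {A B : Hex C} {f g : A.X ⟶ B.X} {hf : Preserves A B f}
    {hg : Preserves A B g} : homMk f hf = homMk g hg ↔ B.Rel f g :=
  Quotient.eq (r := trackedHomSetoid A B)

theorem Preserves.id (A : Hex C) : Preserves A A (𝟙 A.X) := fun I a b h => by simpa using h

theorem Preserves.comp {A B D : Hex C} {f : A.X ⟶ B.X} {g : B.X ⟶ D.X} (hf : Preserves A B f)
    (hg : Preserves B D g) : Preserves A D (f ≫ g) := fun I a b h => by
  simpa using hg _ _ (hf _ _ h)

theorem homMk_comp_eq_iff {A B D : Hex C} {f : A.X ⟶ B.X} {g : B.X ⟶ D.X} {k : A.X ⟶ D.X}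
    {hf : Preserves A B f} {hg : Preserves B D g} {hk : Preserves A D k} :
    homMk f hf ≫ homMk g hg = homMk k hk ↔ D.Rel (f ≫ g) k :=
  homMk_eq_iff (hf := hf.comp hg)

theorem homMk_comp_eq_comp_iff {A B B' D : Hex C} {f : A.X ⟶ B.X} {g : B.X ⟶ D.X}
    {f' : A.X ⟶ B'.X} {g' : B'.X ⟶ D.X} {hf : Preserves A B f} {hg : Preserves B D g}
    {hf' : Preserves A B' f'} {hg' : Preserves B' D g'} :
    homMk f hf ≫ homMk g hg = homMk f' hf' ≫ homMk g' hg' ↔ D.Rel (f ≫ g) (f' ≫ g') :=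
  homMk_eq_iff (hf := hf.comp hg) (hg := hf'.comp hg')

theorem homMk_comp_eq_id_iff {A B : Hex C} {f : A.X ⟶ B.X} {g : B.X ⟶ A.X}
    {hf : Preserves A B f} {hg : Preserves B A g} :
    homMk f hf ≫ homMk g hg = 𝟙 A ↔ A.Rel (f ≫ g) (𝟙 A.X) :=
  homMk_eq_iff (hf := hf.comp hg) (hg := Preserves.id A)

/-! ### Finite limits -/

theorem hasTerminal : HasTerminal (Hex C) := by
  have := PrePathCategory.hasTerminal (C := C)
  have hT : IsHomotopyEquivalenceRelation (diag (⊤_ C)) := by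
    refine isHomotopyEquivalenceRelation_of_equivalence _ (PrePathCategory.trivialFibration_of_isIso _ ?_).1
      (fun _ _ _ => True) (fun _ => ⟨fun _ => trivial, fun _ => trivial, fun _ _ => trivial⟩)
      fun a b => ⟨fun _ => trivial, fun _ => ⟨a, by ext⟩⟩
    exact ⟨⟨prod.fst, by simp, by ext⟩⟩
  let T : Hex C := ⟨⊤_ C, ⊤_ C, diag _, hT⟩
  have hrel : ∀ {I : C} (a b : I ⟶ ⊤_ C), T.Rel a b := fun a b => ⟨a, by ext⟩
  have (A : Hex C) : Unique (A ⟶ T) :=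
    { default := homMk (terminal.from A.X) fun _ _ _ _ => hrel _ _
      uniq := fun u => by
        obtain ⟨f, hf, rfl⟩ := exists_homMk u
        exact homMk_eq_iff.2 (hrel _ _) }
  exact hasTerminal_of_unique T

/-- The explicit pullback in `Hex C`. -/
theorem exists_isPullback {A B D : Hex C} (f : A.X ⟶ D.X) (g : B.X ⟶ D.X)
    (hf : Preserves A D f) (hg : Preserves B D g) :
    ∃ (W : Hex C) (p : W.X ⟶ A.X) (q : W.X ⟶ B.X) (hp : Preserves W A p)
      (hq : Preserves W B q),
      IsPullback (homMk p hp) (homMk q hq) (homMk f hf) (homMk g hg) ∧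
      ∀ {I : C} (a : I ⟶ A.X) (b : I ⟶ B.X), D.Rel (a ≫ f) (b ≫ g) →
        ∃ c : I ⟶ W.X, c ≫ p = a ∧ c ≫ q = b := by
  -- An element of `W` is a pair together with a witness that its images in `D` are related. The
  -- relation put on `W` ignores the witness, which yields uniqueness of lifts.
  obtain ⟨W, w, -, hw⟩ := PrePathCategory.exists_comap (prod.map f g)
    D.isHomotopyEquivalenceRelation.fibration
  obtain ⟨S⟩ := Realization.nonempty_comap₂ A B (w ≫ prod.fst) (w ≫ prod.snd)
  have hp : Preserves S.toHex A (w ≫ prod.fst) := fun I a b h => ((S.rel_iff a b).1 h).1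
  have hq : Preserves S.toHex B (w ≫ prod.snd) := fun I a b h => ((S.rel_iff a b).1 h).2
  have hrel : D.Rel ((w ≫ prod.fst) ≫ f) ((w ≫ prod.snd) ≫ g) := by
    obtain ⟨H, hH⟩ := (hw w).1 ⟨𝟙 W, by simp⟩
    exact ⟨H, by rw [hH]; ext <;> simp⟩
  -- Strict equalities, for an arbitrary `I` in `C`: this also applies to maps that preserve no
  -- relation.
  have hlift : ∀ {I : C} (a : I ⟶ A.X) (b : I ⟶ B.X), D.Rel (a ≫ f) (b ≫ g) →
      ∃ c : I ⟶ W, c ≫ w ≫ prod.fst = a ∧ c ≫ w ≫ prod.snd = b := by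
    intro I a b h
    obtain ⟨c, hc⟩ := (hw (prod.lift a b)).2 (by rw [prod.lift_map]; exact h)
    exact ⟨c, by rw [reassoc_of% hc, prod.lift_fst], by rw [reassoc_of% hc, prod.lift_snd]⟩
  refine ⟨S.toHex, w ≫ prod.fst, w ≫ prod.snd, hp, hq, ⟨⟨homMk_comp_eq_comp_iff.2 hrel⟩, ⟨?_⟩⟩, hlift⟩
  have key : ∀ s : PullbackCone (homMk f hf) (homMk g hg), ∃ u : s.pt ⟶ S.toHex,
      u ≫ homMk _ hp = s.fst ∧ u ≫ homMk _ hq = s.snd := by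
    intro s
    obtain ⟨a, ha, ea⟩ := exists_homMk s.fst
    obtain ⟨b, hb, eb⟩ := exists_homMk s.snd
    have hc := s.condition
    rw [ea, eb, homMk_comp_eq_comp_iff] at hc
    obtain ⟨c, rfl, rfl⟩ := hlift a b hc
    refine ⟨homMk (B := S.toHex) c fun I x y h => (S.rel_iff _ _).2 ⟨?_, ?_⟩, ?_, ?_⟩
    · simpa using ha _ _ h
    · simpa using hb _ _ h
    · exact ea.symm
    · exact eb.symm
  refine PullbackCone.IsLimit.mk _ (fun s => (key s).choose) (fun s => (key s).choose_spec.1)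
    (fun s => (key s).choose_spec.2) fun s m h₁ h₂ => ?_
  have k₁ := h₁.trans (key s).choose_spec.1.symm
  have k₂ := h₂.trans (key s).choose_spec.2.symm
  revert k₁ k₂
  generalize (key s).choose = m'
  obtain ⟨x, hx, rfl⟩ := exists_homMk m
  obtain ⟨y, hy, rfl⟩ := exists_homMk m'
  rw [homMk_comp_eq_comp_iff, homMk_comp_eq_comp_iff]
  exact fun k₁ k₂ => homMk_eq_iff.2 ((S.rel_iff _ _).2 ⟨k₁, k₂⟩)

theorem hasFiniteLimits : HasFiniteLimits (Hex C) := by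
  have : HasTerminal (Hex C) := hasTerminal
  have : HasPullbacks (Hex C) := by
    refine @hasPullbacks_of_hasLimit_cospan _ _ fun {A B D} {u} {v} => ?_
    obtain ⟨f, hf, rfl⟩ := exists_homMk u
    obtain ⟨g, hg, rfl⟩ := exists_homMk v
    obtain ⟨W, p, q, hp, hq, h, -⟩ := exists_isPullback f g hf hg
    exact h.hasPullback
  exact hasFiniteLimits_of_hasTerminal_and_pullbacks

/-! ### Monos, covers and regularity -/

/-- Jointly monic pairs in `Hex C` jointly reflect related elements. -/
theorem rel_of_jointly_mono {A B D : Hex C} (f : A.X ⟶ B.X) (g : A.X ⟶ D.X)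
    (hf : Preserves A B f) (hg : Preserves A D g)
    (h : ∀ (P : Hex C) (u v : P ⟶ A), u ≫ homMk f hf = v ≫ homMk f hf →
      u ≫ homMk g hg = v ≫ homMk g hg → u = v) {I : C} (a b : I ⟶ A.X)
    (h₁ : B.Rel (a ≫ f) (b ≫ f)) (h₂ : D.Rel (a ≫ g) (b ≫ g)) : A.Rel a b := by
  -- `S.R` carries the universal pair `x`, `y` whose images under `f` and `g` are related; every
  -- such pair `a`, `b` factors through it.
  obtain ⟨S⟩ := Realization.nonempty_comap₂ B D f g
  let W := S.R
  let x : W ⟶ A.X := S.ρ ≫ prod.fst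
  let y : W ⟶ A.X := S.ρ ≫ prod.snd
  obtain ⟨hf', hg'⟩ := (S.rel_iff' x y).1 ⟨𝟙 W, by ext <;> simp [x, y]⟩
  -- The coarsest relation on `W` making both `x` and `y` morphisms, so that joint monicity applies
  -- to them.
  obtain ⟨T⟩ := Realization.nonempty_comap₂ A A x y
  have hx : Preserves T.toHex A x := fun I a b h => ((T.rel_iff a b).1 h).1
  have hy : Preserves T.toHex A y := fun I a b h => ((T.rel_iff a b).1 h).2
  have hxy : A.Rel x y := homMk_eq_iff.1 (h T.toHex (homMk x hx) (homMk y hy)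
    (homMk_comp_eq_comp_iff.2 hf') (homMk_comp_eq_comp_iff.2 hg'))
  obtain ⟨H, hH⟩ := (S.rel_iff' a b).2 ⟨h₁, h₂⟩
  have := hxy.precomp H
  rwa [reassoc_of% hH, reassoc_of% hH, prod.lift_fst, prod.lift_snd] at this

theorem mono_homMk_iff {A B : Hex C} (f : A.X ⟶ B.X) (hf : Preserves A B f) :
    Mono (homMk f hf) ↔
      ∀ ⦃I : C⦄ (a b : I ⟶ A.X), B.Rel (a ≫ f) (b ≫ f) → A.Rel a b := by
  constructor
  · intro _ I a b h
    exact rel_of_jointly_mono f f hf hf (fun P u v e _ => (cancel_mono _).1 e) a b h h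
  · refine fun h => ⟨fun u v e => ?_⟩
    obtain ⟨x, hx, rfl⟩ := exists_homMk u
    obtain ⟨y, hy, rfl⟩ := exists_homMk v
    exact homMk_eq_iff.2 (h _ _ (homMk_comp_eq_comp_iff.1 e))

/-- Since a mono reflects `Rel`, a section up to `Rel` automatically preserves it. -/
theorem isIso_homMk {A B : Hex C} (f : A.X ⟶ B.X) (hf : Preserves A B f)
    (hm : Mono (homMk f hf)) (g : B.X ⟶ A.X) (h : B.Rel (g ≫ f) (𝟙 B.X)) :
    IsIso (homMk f hf) := by
  have hg : Preserves B A g := fun I a b hab => by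
    refine (mono_homMk_iff f hf).1 hm _ _ ?_
    have ha := h.precomp a
    have hb := h.precomp b
    simp only [Category.comp_id] at ha hb
    simpa using ha.trans (hab.trans hb.symm)
  have e : homMk g hg ≫ homMk f hf = 𝟙 B := homMk_comp_eq_id_iff.2 h
  exact ⟨homMk g hg, by rw [← cancel_mono (homMk f hf), Category.assoc, e]; simp, e⟩

theorem exists_image {A B : Hex C} (f : A.X ⟶ B.X) (hf : Preserves A B f) :
    ∃ (S : Realization A.X fun _ a b => B.Rel (a ≫ f) (b ≫ f))
      (h₁ : Preserves A S.toHex (𝟙 A.X)) (h₂ : Preserves S.toHex B f),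
      Mono (homMk (A := S.toHex) f h₂) ∧
        homMk (B := S.toHex) (𝟙 A.X) h₁ ≫ homMk (A := S.toHex) f h₂ = homMk f hf := by
  obtain ⟨S⟩ := Realization.nonempty_comap B f
  refine ⟨S, fun I a b h => (S.rel_iff _ _).2 ?_, fun I a b h => (S.rel_iff _ _).1 h,
    (mono_homMk_iff (A := S.toHex) _ _).2 fun I a b h => (S.rel_iff _ _).2 h, ?_⟩
  · simpa only [Category.comp_id] using hf a b h
  · exact homMk_comp_eq_iff.2 (by simpa using Rel.refl f)

/-- For a cover the mono part of the image is invertible, and a representative of its inverse is the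
section. Conversely, a section of `f` gives one of any mono through which `f` factors. -/
theorem isCover_homMk_iff {A B : Hex C} (f : A.X ⟶ B.X) (hf : Preserves A B f) :
    IsCover (homMk f hf) ↔ ∃ g : B.X ⟶ A.X, B.Rel (g ≫ f) (𝟙 B.X) := by
  constructor
  · intro h
    obtain ⟨S, h₁, h₂, hm, e⟩ := exists_image f hf
    have := h (homMk (A := S.toHex) f h₂) hm ⟨_, e⟩
    obtain ⟨g, hg, eg⟩ := exists_homMk (inv (homMk (A := S.toHex) f h₂))
    have := IsIso.inv_hom_id (homMk (A := S.toHex) f h₂)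
    rw [eg] at this
    exact ⟨g, homMk_comp_eq_id_iff.1 this⟩
  · rintro ⟨g, hg⟩ Z m hm ⟨k, hk⟩
    obtain ⟨m, m', rfl⟩ := exists_homMk m
    obtain ⟨k, k', rfl⟩ := exists_homMk k
    refine isIso_homMk m m' hm (g ≫ k) ?_
    have := (homMk_comp_eq_iff.1 hk).precomp g
    simpa using this.trans hg

theorem isRegularCategory : IsRegularCategory (Hex C) where
  toHasFiniteLimits := hasFiniteLimits
  exists_factorisation := by
    intro A B u
    obtain ⟨f, hf, rfl⟩ := exists_homMk u
    obtain ⟨S, h₁, h₂, hm, e⟩ := exists_image f hf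
    exact ⟨_, _, _, (isCover_homMk_iff (B := S.toHex) _ _).2 ⟨𝟙 A.X, by simpa using Rel.refl _⟩, hm, e⟩
  cover_of_isPullback := by
    intro W' X Y Z e' f' u e sq he
    obtain ⟨f, hf, rfl⟩ := exists_homMk u
    obtain ⟨e, e₀, rfl⟩ := exists_homMk e
    obtain ⟨p', hp', rfl⟩ := exists_homMk e'
    obtain ⟨g, hg⟩ := (isCover_homMk_iff _ _).1 he
    obtain ⟨W, p, q, hp, hq, sq', hlift⟩ := exists_isPullback f e hf e₀
    -- The section `g` of `e` induces a section `s` of the explicit pullback; the comparison map `t`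
    -- transports it to the given one.
    obtain ⟨s, hs, -⟩ := hlift (𝟙 X.X) (f ≫ g) (by simpa using (hg.precomp f).symm)
    obtain ⟨t, ht, et⟩ := exists_homMk (sq.lift _ _ sq'.w)
    have h := sq.lift_fst _ _ sq'.w
    rw [et, homMk_comp_eq_iff] at h
    exact (isCover_homMk_iff _ _).2 ⟨s ≫ t, by simpa [hs] using h.precomp s⟩

/-! ### Quotients of equivalence relations -/

/-- The relation on `A` generated by a span in `Hex C`. -/
def SpanRel (A : Hex C) {M : C} (m₁ m₂ : M ⟶ A.X) ⦃I : C⦄ (a b : I ⟶ A.X) : Prop :=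
  ∃ c : I ⟶ M, A.Rel (c ≫ m₁) a ∧ A.Rel (c ≫ m₂) b

/-- Existential quantification over `c` is composition with the projection from `M ⨯ (A.X ⨯ A.X)`,
itself a fibration. -/
theorem exists_fibration_spanRel (A : Hex C) {M : C} (m₁ m₂ : M ⟶ A.X) :
    ∃ (R : C) (p : R ⟶ A.X ⨯ A.X), fibrations C p ∧
      ∀ {I : C} (a b : I ⟶ A.X), (∃ H, H ≫ p = prod.lift a b) ↔ A.SpanRel m₁ m₂ a b := by
  have hA := A.isHomotopyEquivalenceRelation.fibration
  obtain ⟨R₁, p₁, hp₁, h₁⟩ := PrePathCategory.exists_comap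
    (prod.map m₁ (prod.fst : A.X ⨯ A.X ⟶ A.X)) hA
  obtain ⟨R₂, p₂, hp₂, h₂⟩ := PrePathCategory.exists_comap
    (prod.map m₂ (prod.snd : A.X ⨯ A.X ⟶ A.X)) hA
  obtain ⟨R, p, hp, h⟩ := PrePathCategory.exists_inf hp₁ hp₂
  have key : ∀ {I : C} (c : I ⟶ M) (a b : I ⟶ A.X),
      (∃ H, H ≫ p = prod.lift c (prod.lift a b)) ↔ A.Rel (c ≫ m₁) a ∧ A.Rel (c ≫ m₂) b := by
    intro I c a b
    rw [h, h₁, h₂, prod.lift_map, prod.lift_map, prod.lift_fst, prod.lift_snd]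
    rfl
  refine ⟨R, p ≫ prod.snd, PrePathCategory.fibration_comp _ _ hp
    (PrePathCategory.fibration_snd _ _), fun a b => ⟨?_, ?_⟩⟩
  · rintro ⟨H, hH⟩
    exact ⟨H ≫ p ≫ prod.fst, (key _ a b).1 ⟨H, by rw [← hH]; apply prod.hom_ext <;> simp⟩⟩
  · rintro ⟨c, hc⟩
    obtain ⟨H, hH⟩ := (key c a b).2 hc
    exact ⟨H, by rw [reassoc_of% hH, prod.lift_snd]⟩

/-- An equivalence relation in `Hex C`, presented by a span, has an equivalence relation as its
relation on generalized elements. -/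
theorem spanRel_equivalence {A M : Hex C} (m₁ m₂ : M.X ⟶ A.X) (h₁ : Preserves M A m₁)
    (h₂ : Preserves M A m₂)
    (h : ∀ P : Hex C, Equivalence (fun a b : P ⟶ A =>
      ∃ r : P ⟶ M, r ≫ homMk m₁ h₁ = a ∧ r ≫ homMk m₂ h₂ = b)) (I : C) :
    Equivalence (A.SpanRel m₁ m₂ (I := I)) where
  refl a := by
    obtain ⟨r, e₁, e₂⟩ := (h A).refl (𝟙 A)
    obtain ⟨r, hr, rfl⟩ := exists_homMk r
    exact ⟨a ≫ r, by simpa using (homMk_comp_eq_id_iff.1 e₁).precomp a,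
      by simpa using (homMk_comp_eq_id_iff.1 e₂).precomp a⟩
  symm := by
    rintro a b ⟨c, ha, hb⟩
    -- Symmetry for the generic related pair, the two legs of the span.
    obtain ⟨r, e₁, e₂⟩ := (h M).symm ⟨𝟙 M, rfl, rfl⟩
    obtain ⟨r, hr, rfl⟩ := exists_homMk r
    rw [Category.id_comp, homMk_comp_eq_iff] at e₁ e₂
    exact ⟨c ≫ r, by simpa using (e₁.precomp c).trans hb,
      by simpa using (e₂.precomp c).trans ha⟩
  trans := by
    rintro a b d ⟨x, xa, xb⟩ ⟨y, yb, yd⟩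
    -- The explicit pullback is the generic composable pair; `x` and `y` then lift to it strictly.
    obtain ⟨W, p, q, hp, hq, sq, hlift⟩ := exists_isPullback m₂ m₁ h₂ h₁
    obtain ⟨r, e₁, e₂⟩ := (h W).trans ⟨homMk p hp, rfl, rfl⟩ ⟨homMk q hq, sq.w.symm, rfl⟩
    obtain ⟨r, hr, rfl⟩ := exists_homMk r
    rw [homMk_comp_eq_comp_iff] at e₁ e₂
    obtain ⟨c, rfl, rfl⟩ := hlift x y (xb.trans yb.symm)
    simp only [Category.assoc] at xa yd
    exact ⟨c ≫ r, by simpa using (e₁.precomp c).trans xa,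
      by simpa using (e₂.precomp c).trans yd⟩

theorem exists_quotient_span {A M : Hex C} (m₁ m₂ : M ⟶ A)
    (hm : ∀ (P : Hex C) (u v : P ⟶ M), u ≫ m₁ = v ≫ m₁ → u ≫ m₂ = v ≫ m₂ → u = v)
    (h : ∀ P : Hex C, Equivalence (fun a b : P ⟶ A =>
      ∃ r : P ⟶ M, r ≫ m₁ = a ∧ r ≫ m₂ = b)) :
    ∃ (Q : Hex C) (q : A ⟶ Q), IsCover q ∧ IsPullback m₁ m₂ q q := by
  obtain ⟨m₁, h₁, rfl⟩ := exists_homMk m₁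
  obtain ⟨m₂, h₂, rfl⟩ := exists_homMk m₂
  have heq := spanRel_equivalence m₁ m₂ h₁ h₂ h
  obtain ⟨R, p, hp, hR⟩ := exists_fibration_spanRel A m₁ m₂
  let Q : Hex C := ⟨A.X, R, p, isHomotopyEquivalenceRelation_of_equivalence p hp _ heq hR⟩
  have hQ : ∀ {I : C} (a b : I ⟶ A.X), Q.Rel a b ↔ A.SpanRel m₁ m₂ a b := hR
  have hq : Preserves A Q (𝟙 A.X) := fun I a b hab => by
    -- A witness for `(a, a)` also witnesses `(a, b)`, as the second leg matters only up to `A.Rel`.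
    obtain ⟨c, ca, cb⟩ := (heq I).refl a
    exact (hQ _ _).2 ⟨c, by simpa using ca, by simpa using cb.trans hab⟩
  refine ⟨Q, homMk (B := Q) (𝟙 A.X) hq, (isCover_homMk_iff _ _).2
    ⟨𝟙 A.X, by simpa using Rel.refl (A := Q) (𝟙 A.X)⟩, ⟨⟨homMk_comp_eq_comp_iff.2 ((hQ _ _).2
      ⟨𝟙 M.X, by simpa using Rel.refl _, by simpa using Rel.refl _⟩)⟩, ⟨?_⟩⟩⟩
  have key : ∀ s : PullbackCone (homMk (B := Q) (𝟙 A.X) hq) (homMk (B := Q) (𝟙 A.X) hq),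
      ∃ u : s.pt ⟶ M, u ≫ homMk m₁ h₁ = s.fst ∧ u ≫ homMk m₂ h₂ = s.snd := by
    intro s
    obtain ⟨a, ha, ea⟩ := exists_homMk s.fst
    obtain ⟨b, hb, eb⟩ := exists_homMk s.snd
    have hc := s.condition
    rw [ea, eb, homMk_comp_eq_comp_iff] at hc
    obtain ⟨c, ca, cb⟩ := (hQ _ _).1 hc
    rw [Category.comp_id] at ca cb
    rw [ea, eb]
    -- The witness `c` is a priori only a map of `C`; joint monicity forces it to preserve the
    -- relation.
    refine ⟨homMk c fun I x y hxy => rel_of_jointly_mono m₁ m₂ h₁ h₂ hm _ _ ?_ ?_,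
      homMk_comp_eq_iff.2 ca, homMk_comp_eq_iff.2 cb⟩
    · simpa using (ca.precomp x).trans ((ha _ _ hxy).trans (ca.precomp y).symm)
    · simpa using (cb.precomp x).trans ((hb _ _ hxy).trans (cb.precomp y).symm)
  exact PullbackCone.IsLimit.mk _ (fun s => (key s).choose) (fun s => (key s).choose_spec.1)
    (fun s => (key s).choose_spec.2) fun s m e₁ e₂ =>
      hm _ _ _ (e₁.trans (key s).choose_spec.1.symm) (e₂.trans (key s).choose_spec.2.symm)

end Hex

theorem mainTheorem2 (C : Type u) [Category.{v} C] [CategoryWithFibrations C]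
    [CategoryWithWeakEquivalences C] [PathCategory C] : IsExactCategory (Hex C) := by
  have := Hex.isRegularCategory (C := C)
  refine { exists_quotient := fun {X R} m hm => ?_ }
  have := hm.mono
  refine Hex.exists_quotient_span (m ≫ prod.fst) (m ≫ prod.snd) (fun P u v e₁ e₂ => ?_)
    hm.equivalence
  rw [← cancel_mono m]
  apply prod.hom_ext <;> simpa
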